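/- Let $R$ be a commutative ring with identity, let $n\ge 1$, and let $x=(x_1,\dots,x_n)$. For each $k\in\{1,\dots,n\}$ let $S_k\subseteq R$ be a finite set, let $E_k\subseteq S_k$, and let $\psi_k$ assign to every $u\in S_k$ a positive integer $\psi_k(u)$. Assume that every $S_k$ satisfies Condition (D): for all $a\ne b$ in $S_k$, the element $b-a$ is not a zero divisor of $R$ (that is, $(b-a)w=0$ implies $w=0$). Put $$g_k=\prod_{u\in S_k}(x_k-u)^{\psi_k(u)},\qquad h_k=\prod_{u\in E_k}(x_k-u)^{\psi_k(u)},$$ so that $g_k/h_k=\prod_{u\in S_k\setminus E_k}(x_k-u)^{\psi_k(u)}$. For $t\in\mathbb N=\{0,1,2,\dots\}$ and $p_1,\dots,p_n\in R[x_1,\dots,x_n]$, let $\mathcal I_t(p_1,\dots,p_n)$ be the ideal of $R[x_1,\dots,x_n]$ generated by all products $\prod_{k=1}^n p_k^{\alpha_k}$ with $\alpha\in\mathbb N^n$ and $\sum_{k}\alpha_k=t$. Exponents in $\mathbb N^n$ are compared coordinatewise; $\operatorname{supp}(f)$ is the set of exponents of the monomials with nonzero coefficient in $f$, and $\Delta(A)=\{\beta\in\mathbb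 N^n : \beta\le\alpha\text{ for some }\alpha\in A\}$ for $A\subseteq\mathbb N^n$. Let $t\in\mathbb N$ and $f\in R[x_1,\dots,x_n]$. Consider the condition $(\ast)$ for every $a\in\prod_{i=1}^n S_i\setminus\prod_{i=1}^n E_i$ and every $\beta\in\mathbb N^n$ with $\sum_{i=1}^n\lfloor\beta_i/\psi_i(a_i)\rfloor\le t-1$, the coefficient of $x^\beta$ in $f(x_1+a_1,\dots,x_n+a_n)$ is $0$. (1) $f\in\bigcap_{m=1}^n\mathcal I_t(g_1,\dots,g_{m-1},g_m/h_m,g_{m+1},\dots,g_n)$ if and only if $(\ast)$ holds. (2) Suppose that $(\ast)$ holds. Then there is a unique $\eta\in R[x_1,\dots,x_n]$ such that $f-\eta\in\mathcal I_t(g_1,\dots,g_n)$ and such that for all $\beta\in\operatorname{supp}(\eta)$ and all $\alpha\in\mathbb N^n$ with $\sum_i\alpha_i=t$ there is a $k$ with $\beta_k\le\bigl(\sum_{u\in S_k}\psi_k(u)\bigr)\alpha_k-1$. Moreover, $\operatorname{supp}(\eta)\subseteq\Delta(\operatorname{supp}(f))$ and $\prod_{k=1}^n(g_k/h_k)$ divides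 $\eta$. If in addition $t\ge1$ and $f(w)\neq0$ for some $w\in\prod_{i=1}^nS_i$, then $\eta\ne0$, and for every $m\in\{1,\dots,n\}$ the total degrees satisfy $$\deg(f)\ \ge\ \deg(\eta)\ \ge\ (t-1)\sum_{u\in S_m\setminus E_m}\psi_m(u)+\sum_{k=1}^n\ \sum_{u\in S_k\setminus E_k}\psi_k(u).$$ -/

import Mathlib

namespace PuncturedNSS

open MvPolynomial

/-- Condition (D) for a set `X` of elements of a commutative ring `R`: the difference of any two
distinct elements of `X` is not a zero divisor. -/
def ConditionD {R : Type*} [CommRing R] (X : Set R) : Prop :=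
  ∀ a ∈ X, ∀ b ∈ X, a ≠ b → b - a ∈ nonZeroDivisors R

/-- The polynomial `∏_{u ∈ A} (x_k - u) ^ ψ(u)` attached to a finite multiset `(A, ψ)` and the
variable `x_k`. -/
noncomputable def multisetPoly {R : Type*} [CommRing R] {n : ℕ} (k : Fin n) (A : Finset R)
    (ψ : R → ℕ) : MvPolynomial (Fin n) R :=
  ∏ u ∈ A, (X k - C u) ^ ψ u

/-- For `E ⊆ S`, `g = ∏_{u ∈ S} (x_k - u) ^ ψ(u)` and `h = ∏_{u ∈ E} (x_k - u) ^ ψ(u)`, the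
quotient `g / h`. The two lemmas below show that it is the unique polynomial `q` with
`g = q * h`. -/
noncomputable def quotPoly {R : Type*} [CommRing R] [DecidableEq R] {n : ℕ} (k : Fin n)
    (S E : Finset R) (ψ : R → ℕ) : MvPolynomial (Fin n) R :=
  multisetPoly k (S \ E) ψ

theorem quotPoly_mul {R : Type*} [CommRing R] [DecidableEq R] {n : ℕ} (k : Fin n)
    {S E : Finset R} (hE : E ⊆ S) (ψ : R → ℕ) :
    quotPoly k S E ψ * multisetPoly k E ψ = multisetPoly k S ψ :=
  Finset.prod_sdiff hE

theorem eq_quotPoly {R : Type*} [CommRing R] [DecidableEq R] {n : ℕ} (k : Fin n)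
    {S E : Finset R} (hE : E ⊆ S) (ψ : R → ℕ) (q : MvPolynomial (Fin n) R)
    (hq : q * multisetPoly k E ψ = multisetPoly k S ψ) : q = quotPoly k S E ψ := by
  have hm : (MonomialOrder.lex (σ := Fin n)).Monic (multisetPoly k E ψ) :=
    MonomialOrder.Monic.prod fun u _ => (MonomialOrder.monic_X_sub_C _ k u).pow
  by_contra hne
  have h0 : (q - quotPoly k S E ψ) * multisetPoly k E ψ = 0 := by
    rw [sub_mul, hq, quotPoly_mul k hE, sub_self]
  have h1 := (MonomialOrder.lex (σ := Fin n)).leadingCoeff_mul_of_right_mem_nonZeroDivisors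
    (f := q - quotPoly k S E ψ) (g := multisetPoly k E ψ)
    (by rw [hm.leadingCoeff_eq_one]; exact one_mem _)
  rw [h0, hm.leadingCoeff_eq_one, mul_one, MonomialOrder.leadingCoeff_zero] at h1
  exact hne (sub_eq_zero.mp (MonomialOrder.leadingCoeff_eq_zero_iff.mp h1.symm))

/-- The ideal `I_t(g_1, …, g_n)` generated by all the products `∏_k g_k ^ α_k` with
`α ∈ ℕ^n` and `∑_k α_k = t`. -/
noncomputable def powIdeal {R : Type*} [CommRing R] {n : ℕ} (t : ℕ) (g : Fin n → MvPolynomial (Fin n) R) :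
    Ideal (MvPolynomial (Fin n) R) :=
  Ideal.span {p | ∃ α : Fin n → ℕ, ∑ k, α k = t ∧ p = ∏ k, g k ^ α k}

/-- The translated polynomial `f(x_1 + a_1, …, x_n + a_n)`. -/
noncomputable def shift {R : Type*} [CommRing R] {n : ℕ} (a : Fin n → R)
    (f : MvPolynomial (Fin n) R) : MvPolynomial (Fin n) R :=
  bind₁ (fun i => X i + C (a i)) f

/-- `f` vanishes at `a` to order `t` with respect to the multiplicities `ψ_1(a_1), …, ψ_n(a_n)`:
the coefficient of `x ^ β` in `f(x + a)` is zero for every `β ∈ ℕ^n` with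
`∑_i ⌊β_i / ψ_i(a_i)⌋ ≤ t - 1`. -/
def VanishesToOrder {R : Type*} [CommRing R] {n : ℕ} (ψ : Fin n → R → ℕ) (t : ℕ)
    (f : MvPolynomial (Fin n) R) (a : Fin n → R) : Prop :=
  ∀ β : Fin n →₀ ℕ, ∑ i, β i / ψ i (a i) < t → (shift a f).coeff β = 0

/-- `η` is a reduced remainder of `f` modulo `I_t(g_1, …, g_n)`, where
`g_k = ∏_{u ∈ S_k} (x_k - u) ^ ψ_k(u)`: the difference `f - η` lies in this ideal and no exponent
of `η` is coordinatewise at least `(α_k ∑_{u ∈ S_k} ψ_k(u))_k` for an `α ∈ ℕ^n` of sum `t`. -/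
def IsReducedRemainder {R : Type*} [CommRing R] {n : ℕ} (S : Fin n → Finset R)
    (ψ : Fin n → R → ℕ) (t : ℕ) (f η : MvPolynomial (Fin n) R) : Prop :=
  f - η ∈ powIdeal t (fun k => multisetPoly k (S k) (ψ k)) ∧
    ∀ β ∈ η.support, ∀ α : Fin n → ℕ, ∑ i, α i = t → ∃ k, β k < (∑ u ∈ S k, ψ k u) * α k

end PuncturedNSS

namespace PuncturedNSS

open MvPolynomial

section NodeSequence

/-- The periodic sequence with period the list `L`. -/
def cycle {M : Type*} [Zero M] (L : List M) (i : ℕ) : M := L.getD (i % L.length) 0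

@[to_additive]
theorem prod_range_cycle_of_le {M N : Type*} [Zero M] [CommMonoid N] (L : List M) (F : M → N)
    (r : ℕ) (hr : r ≤ L.length) :
    ∏ l ∈ Finset.range r, F (cycle L l) = ((L.take r).map F).prod := by
  induction r with
  | zero => simp
  | succ r ih =>
    have hlt : r < L.length := hr
    rw [Finset.prod_range_succ, ih hlt.le, List.take_succ_eq_append_getElem hlt]
    simp [cycle, Nat.mod_eq_of_lt hlt, hlt]

theorem cycle_add_length {M : Type*} [Zero M] (L : List M) (i : ℕ) :
    cycle L (L.length + i) = cycle L i := by
  simp [cycle]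

@[to_additive]
theorem prod_range_cycle {M N : Type*} [Zero M] [CommMonoid N] (L : List M) (F : M → N)
    (q r : ℕ) (hr : r ≤ L.length) :
    ∏ l ∈ Finset.range (L.length * q + r), F (cycle L l) =
      (L.map F).prod ^ q * ((L.take r).map F).prod := by
  induction q with
  | zero => simpa using prod_range_cycle_of_le L F r hr
  | succ q ih =>
    have h : L.length * (q + 1) + r = L.length + (L.length * q + r) := by ring
    rw [h, Finset.prod_range_add]
    simp only [cycle_add_length]
    rw [ih, prod_range_cycle_of_le L F _ le_rfl, List.take_length, pow_succ', mul_assoc]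

theorem cycle_mem {M : Type*} [Zero M] (L : List M) (hL : 0 < L.length) (i : ℕ) :
    cycle L i ∈ L := by
  have := Nat.mod_lt i hL
  simp [cycle, this]

theorem sum_map_ite_eq_count {M : Type*} [DecidableEq M] (L : List M) (a : M) :
    (L.map fun u => if u = a then 1 else 0).sum = L.count a := by
  induction L with
  | nil => simp
  | cons b L ih => by_cases h : b = a <;> simp [ih, h, add_comm]

/-- The number of earlier visits of a periodic sequence to its `i`-th value. -/
theorem card_filter_cycle {M : Type*} [Zero M] [DecidableEq M] (L : List M) (hL : 0 < L.length)
    (i : ℕ) :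
    ((Finset.range i).filter fun l => cycle L l = cycle L i).card / L.count (cycle L i) =
      i / L.length := by
  have hr := Nat.mod_lt i hL
  set a := cycle L i with ha
  have hget : L[i % L.length] = a := by simp [ha, cycle, hr]
  have hcard : ((Finset.range i).filter fun l => cycle L l = a).card =
      i / L.length * L.count a + (L.take (i % L.length)).count a := by
    have h := sum_range_cycle L (fun u => if u = a then 1 else 0) (i / L.length) (i % L.length)
      hr.le
    rw [Nat.div_add_mod, sum_map_ite_eq_count, sum_map_ite_eq_count, smul_eq_mul] at h
    rw [Finset.card_filter, h]
  have hlt : (L.take (i % L.length)).count a < L.count a := by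
    have h1 : (L.take (i % L.length + 1)).count a ≤ L.count a :=
      (List.take_sublist _ _).count_le a
    rw [List.take_succ_eq_append_getElem hr, List.count_append, hget] at h1
    simp at h1
    omega
  rw [hcard, mul_comm, Nat.mul_add_div (by omega), Nat.div_eq_of_lt hlt, add_zero]

/-- The finite multiset with underlying set `A` and multiplicities `ψ`. -/
def nodeMultiset {M : Type*} (A : Finset M) (ψ : M → ℕ) : Multiset M :=
  ∑ u ∈ A, Multiset.replicate (ψ u) u

theorem card_nodeMultiset {M : Type*} (A : Finset M) (ψ : M → ℕ) :
    (nodeMultiset A ψ).card = ∑ u ∈ A, ψ u := by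
  simp [nodeMultiset]

theorem count_nodeMultiset {M : Type*} [DecidableEq M] (A : Finset M) (ψ : M → ℕ) (a : M) :
    (nodeMultiset A ψ).count a = if a ∈ A then ψ a else 0 := by
  simp [nodeMultiset, Multiset.count_sum', Multiset.count_replicate]

theorem prod_map_nodeMultiset {M N : Type*} [CommMonoid N] (A : Finset M) (ψ : M → ℕ) (F : M → N) :
    ((nodeMultiset A ψ).map F).prod = ∏ u ∈ A, F u ^ ψ u := by
  classical
  induction A using Finset.induction_on with
  | empty => simp [nodeMultiset]
  | insert b A hb ih =>
    rw [Finset.prod_insert hb, ← ih, nodeMultiset, Finset.sum_insert hb]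
    simp [nodeMultiset]

/-- A list of the elements of `S` with multiplicities `ψ`, those of `S \ E` first. -/
noncomputable def nodeList {M : Type*} [DecidableEq M] (S E : Finset M) (ψ : M → ℕ) : List M :=
  (nodeMultiset (S \ E) ψ).toList ++ (nodeMultiset E ψ).toList




theorem length_nodeList {M : Type*} [DecidableEq M] {S E : Finset M} (hE : E ⊆ S) (ψ : M → ℕ) :
    (nodeList S E ψ).length = ∑ u ∈ S, ψ u := by
  simp [nodeList, card_nodeMultiset, Finset.sum_sdiff hE]

theorem count_nodeList {M : Type*} [DecidableEq M] {S E : Finset M} (ψ : M → ℕ)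
    {a : M} (ha : a ∈ S) : (nodeList S E ψ).count a = ψ a := by
  rw [nodeList, List.count_append, ← Multiset.coe_count, ← Multiset.coe_count,
    Multiset.coe_toList, Multiset.coe_toList, count_nodeMultiset, count_nodeMultiset]
  by_cases h : a ∈ E <;> simp [h, ha]

theorem mem_of_mem_nodeList {M : Type*} [DecidableEq M] {S E : Finset M} (hE : E ⊆ S) (ψ : M → ℕ)
    {a : M} (ha : a ∈ nodeList S E ψ) : a ∈ S := by
  simp only [nodeList, List.mem_append, Multiset.mem_toList] at ha
  rcases ha with h | h <;> rw [← Multiset.count_pos, count_nodeMultiset] at h <;>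
    split_ifs at h with h'
  · exact (Finset.mem_sdiff.1 h').1
  · omega
  · exact hE h'
  · omega

theorem prod_map_nodeList {M N : Type*} [DecidableEq M] [CommMonoid N] {S E : Finset M}
    (hE : E ⊆ S) (ψ : M → ℕ) (F : M → N) :
    ((nodeList S E ψ).map F).prod = ∏ u ∈ S, F u ^ ψ u := by
  rw [← Finset.prod_sdiff hE, ← prod_map_nodeMultiset, ← prod_map_nodeMultiset, nodeList,
    List.map_append, List.prod_append]
  simp only [← Multiset.prod_coe, ← Multiset.map_coe, Multiset.coe_toList]

theorem prod_range_mul_cycle_nodeList {M N : Type*} [Zero M] [DecidableEq M] [CommMonoid N]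
    {S E : Finset M} (hE : E ⊆ S) (ψ : M → ℕ) (F : M → N) (q : ℕ) :
    ∏ l ∈ Finset.range ((∑ u ∈ S, ψ u) * q), F (cycle (nodeList S E ψ) l) =
      (∏ u ∈ S, F u ^ ψ u) ^ q := by
  simpa [length_nodeList hE, prod_map_nodeList hE] using
    prod_range_cycle (nodeList S E ψ) F q 0 (Nat.zero_le _)

theorem prod_range_sdiff_cycle_nodeList {M N : Type*} [Zero M] [DecidableEq M] [CommMonoid N]
    (S E : Finset M) (ψ : M → ℕ) (F : M → N) :
    ∏ l ∈ Finset.range (∑ u ∈ S \ E, ψ u), F (cycle (nodeList S E ψ) l) =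
      ∏ u ∈ S \ E, F u ^ ψ u := by
  have hlen : (nodeMultiset (S \ E) ψ).toList.length = ∑ u ∈ S \ E, ψ u := by
    simp [card_nodeMultiset]
  rw [prod_range_cycle_of_le _ _ _ (by simp [nodeList, card_nodeMultiset]), ← hlen, nodeList,
    List.take_left', ← prod_map_nodeMultiset, ← Multiset.prod_coe, ← Multiset.map_coe,
    Multiset.coe_toList]
  rfl

/-- A value of the node sequence at an index below `∑ u ∈ S \ E, ψ u` is not in `E`. -/
theorem cycle_nodeList_mem_sdiff {M : Type*} [Zero M] [DecidableEq M] (S E : Finset M)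
    (ψ : M → ℕ) {i : ℕ} (hi : i < ∑ u ∈ S \ E, ψ u) : cycle (nodeList S E ψ) i ∉ E := by
  have hlen : (nodeMultiset (S \ E) ψ).toList.length = ∑ u ∈ S \ E, ψ u := by
    simp [card_nodeMultiset]
  have hi' := hi
  rw [← hlen] at hi'
  have hmem : cycle (nodeList S E ψ) i ∈ nodeMultiset (S \ E) ψ := by
    have h : i < (nodeList S E ψ).length := by
      simp only [nodeList, List.length_append]; omega
    rw [cycle, Nat.mod_eq_of_lt h, List.getD_eq_getElem _ _ h, ← Multiset.mem_toList]
    simp only [nodeList, List.getElem_append_left hi', List.getElem_mem]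
  rw [← Multiset.count_pos, count_nodeMultiset] at hmem
  split_ifs at hmem with h
  · exact (Finset.mem_sdiff.1 h).2
  · omega

end NodeSequence

section NewtonBasis

variable {R : Type*} [CommRing R] {n : ℕ}

/-- The product of the first `β k` linear factors `x_k - z_k(l)`, over all `k`. -/
noncomputable def newton (z : Fin n → ℕ → R) (β : Fin n →₀ ℕ) : MvPolynomial (Fin n) R :=
  ∏ k, ∏ l ∈ Finset.range (β k), (X k - C (z k l))

theorem newton_add_single (z : Fin n → ℕ → R) (β : Fin n →₀ ℕ) (k : Fin n) :
    newton z (β + Finsupp.single k 1) = newton z β * (X k - C (z k (β k))) := by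
  unfold newton
  rw [← Finset.mul_prod_erase _ _ (Finset.mem_univ k),
    ← Finset.mul_prod_erase (Finset.univ) (fun k => ∏ l ∈ Finset.range (β k), (X k - C (z k l)))
      (Finset.mem_univ k)]
  have h : ∀ j ∈ Finset.univ.erase k,
      ∏ l ∈ Finset.range ((β + Finsupp.single k 1 : Fin n →₀ ℕ) j), (X j - C (z j l)) =
        ∏ l ∈ Finset.range (β j), (X j - C (z j l) : MvPolynomial (Fin n) R) := by
    intro j hj
    simp [Finset.ne_of_mem_erase hj]
  rw [Finset.prod_congr rfl h]
  simp only [Finsupp.add_apply, Finsupp.single_eq_same, Finset.prod_range_succ]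
  ring

theorem newton_dvd (z : Fin n → ℕ → R) {α : Fin n → ℕ} {β : Fin n →₀ ℕ} (h : ∀ k, α k ≤ β k) :
    ∏ k, ∏ l ∈ Finset.range (α k), (X k - C (z k l)) ∣ newton z β :=
  Finset.prod_dvd_prod_of_dvd _ _ fun k _ =>
    Finset.prod_dvd_prod_of_subset _ _ _ (Finset.range_mono (h k))

theorem degreeOf_newton_le (z : Fin n → ℕ → R) (β : Fin n →₀ ℕ) (i : Fin n) :
    degreeOf i (newton z β) ≤ β i := by
  refine (degreeOf_prod_le _ _ _).trans ?_
  have h : ∀ k, degreeOf i (∏ l ∈ Finset.range (β k), (X k - C (z k l) : MvPolynomial (Fin n) R))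
      ≤ if i = k then β k else 0 := by
    intro k
    refine (degreeOf_prod_le _ _ _).trans ?_
    have h1 : ∀ l ∈ Finset.range (β k),
        degreeOf i (X k - C (z k l) : MvPolynomial (Fin n) R) ≤ if i = k then 1 else 0 := by
      intro l _
      rcases subsingleton_or_nontrivial R with hR | hR
      · rw [Subsingleton.elim (X k - C (z k l)) 0, degreeOf_zero]
        exact Nat.zero_le _
      refine (degreeOf_sub_le _ _ _).trans ?_
      rw [degreeOf_C, degreeOf_X]
      simp
    refine (Finset.sum_le_sum h1).trans ?_
    split_ifs <;> simp
  refine (Finset.sum_le_sum fun k _ => h k).trans ?_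
  simp

theorem le_of_mem_support_newton (z : Fin n → ℕ → R) {β γ : Fin n →₀ ℕ}
    (h : γ ∈ (newton z β).support) : γ ≤ β := fun i =>
  (degreeOf_le_iff.1 (degreeOf_newton_le z β i) γ h)

/-- A monomial is a combination of the `newton z γ` with smaller exponent. -/
theorem monomial_mem_span_newton (z : Fin n → ℕ → R) (β : Fin n →₀ ℕ) :
    (monomial β 1 : MvPolynomial (Fin n) R) ∈ Submodule.span R (newton z '' Set.Iic β) := by
  induction β using WellFoundedLT.induction with
  | _ β ih =>
    by_cases h0 : β = 0
    · subst h0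
      refine Submodule.subset_span ⟨0, Set.mem_Iic.2 le_rfl, ?_⟩
      simp [newton]
    obtain ⟨k, hk⟩ := Finsupp.ne_iff.1 h0
    have hle : Finsupp.single k 1 ≤ β := by
      rw [Finsupp.single_le_iff]
      exact Nat.one_le_iff_ne_zero.2 hk
    obtain ⟨α, rfl⟩ := exists_add_of_le hle
    rw [add_comm] at ih ⊢
    have hlt : α < α + Finsupp.single k 1 := by
      refine lt_of_le_of_ne le_self_add fun h => ?_
      have := DFunLike.congr_fun h k
      simp at this
    rw [monomial_add_single, pow_one]
    refine Submodule.span_induction (p := fun p _ => p * X k ∈ _) ?_ ?_ ?_ ?_ (ih α hlt)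
    · rintro _ ⟨γ, hγ, rfl⟩
      have h1 : newton z γ * X k =
          newton z (γ + Finsupp.single k 1) + z k (γ k) • newton z γ := by
        rw [newton_add_single, smul_eq_C_mul]
        ring
      rw [h1]
      refine Submodule.add_mem _ (Submodule.subset_span ⟨_, ?_, rfl⟩)
        (Submodule.smul_mem _ _ (Submodule.subset_span ⟨_, ?_, rfl⟩))
      · exact Set.mem_Iic.2 (add_le_add_left hγ _)
      · exact Set.mem_Iic.2 (le_trans hγ hlt.le)
    · simp
    · intro p q _ _ hp hq
      rw [add_mul]
      exact Submodule.add_mem _ hp hq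
    · intro r p _ hp
      rw [smul_mul_assoc]
      exact Submodule.smul_mem _ _ hp

theorem mem_span_newton (z : Fin n → ℕ → R) (f : MvPolynomial (Fin n) R) {D : Set (Fin n →₀ ℕ)}
    (hD : ∀ γ ∈ f.support, ∀ β ≤ γ, β ∈ D) :
    f ∈ Submodule.span R (newton z '' D) := by
  rw [f.as_sum]
  refine Submodule.sum_mem _ fun γ hγ => ?_
  have h : (monomial γ (coeff γ f) : MvPolynomial (Fin n) R) = coeff γ f • monomial γ 1 := by
    simp [smul_monomial]
  rw [h]
  exact Submodule.smul_mem _ _ (Submodule.span_mono (Set.image_mono fun β hβ => hD γ hγ β hβ)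
    (monomial_mem_span_newton z γ))

theorem exists_eq_sum_newton (z : Fin n → ℕ → R) (f : MvPolynomial (Fin n) R)
    {D : Set (Fin n →₀ ℕ)} (hD : ∀ γ ∈ f.support, ∀ β ≤ γ, β ∈ D) :
    ∃ c : (Fin n →₀ ℕ) →₀ R, (∀ β ∈ c.support, β ∈ D) ∧
      f = ∑ β ∈ c.support, C (c β) * newton z β := by
  obtain ⟨c, hc, h⟩ := (Finsupp.mem_span_image_iff_linearCombination R).1
    (mem_span_newton z f hD)
  refine ⟨c, fun β hβ => (Finsupp.mem_supported R c).1 hc hβ, ?_⟩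
  rw [← h, Finsupp.linearCombination_apply, Finsupp.sum]
  simp [smul_eq_C_mul]

/-- Translation as a ring homomorphism. -/
noncomputable def shiftHom (a : Fin n → R) : MvPolynomial (Fin n) R →ₐ[R] MvPolynomial (Fin n) R :=
  bind₁ fun i => X i + C (a i)

theorem shiftHom_apply (a : Fin n → R) (f : MvPolynomial (Fin n) R) :
    shiftHom a f = shift a f := rfl

theorem shift_X_sub_C (a : Fin n → R) (k : Fin n) (u : R) :
    shift a (X k - C u) = X k + C (a k - u) := by
  rw [← shiftHom_apply, map_sub]
  simp [shiftHom, algHom_C]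
  ring

theorem shift_newton (a : Fin n → R) (z : Fin n → ℕ → R) (β : Fin n →₀ ℕ) :
    shift a (newton z β) = ∏ k, ∏ l ∈ Finset.range (β k), (X k + C (a k - z k l)) := by
  simp only [newton, ← shiftHom_apply, map_prod]
  simp only [shiftHom_apply, shift_X_sub_C]

/-- The order of vanishing at `z(β)`, in each coordinate, of the `newton z β`. -/
noncomputable def nodeOrder [DecidableEq R] (z : Fin n → ℕ → R) (β : Fin n →₀ ℕ) : Fin n →₀ ℕ :=
  Finsupp.equivFunOnFinite.symm fun k =>
    ((Finset.range (β k)).filter fun l => z k l = z k (β k)).card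

theorem coeff_shift_newton_of_not_le [DecidableEq R] (z : Fin n → ℕ → R) {β γ : Fin n →₀ ℕ}
    (h : ¬ γ ≤ β) :
    (shift (fun k => z k (β k)) (newton z γ)).coeff (nodeOrder z β) = 0 := by
  obtain ⟨k, hk⟩ : ∃ k, β k < γ k := by
    by_contra! h'
    exact h fun k => h' k
  have hdvd : (X k : MvPolynomial (Fin n) R) ^ (nodeOrder z β k + 1) ∣
      shift (fun k => z k (β k)) (newton z γ) := by
    rw [shift_newton]
    refine Dvd.dvd.trans ?_ (Finset.dvd_prod_of_mem _ (Finset.mem_univ k))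
    rw [← Finset.prod_filter_mul_prod_filter_not _ (fun l => z k l = z k (β k))]
    refine Dvd.dvd.mul_right ?_ _
    rw [Finset.prod_congr rfl (g := fun _ => X k), Finset.prod_const]
    · refine pow_dvd_pow _ ?_
      rw [nodeOrder, Finsupp.equivFunOnFinite_symm_apply_apply, ← Finset.card_insert_of_notMem
        (a := β k) (by simp)]
      refine Finset.card_le_card fun l hl => ?_
      simp only [Finset.mem_insert, Finset.mem_filter, Finset.mem_range] at hl ⊢
      rcases hl with rfl | ⟨h1, h2⟩
      · exact ⟨hk, rfl⟩
      · exact ⟨h1.trans hk, h2⟩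
    · intro l hl
      simp [(Finset.mem_filter.1 hl).2]
  obtain ⟨q, hq⟩ := hdvd
  rw [hq, X_pow_eq_monomial, coeff_monomial_mul', if_neg]
  intro hle
  simpa using hle k

theorem coeff_shift_newton_self [DecidableEq R] (z : Fin n → ℕ → R)
    (hz : ∀ k l l', z k l ≠ z k l' → z k l - z k l' ∈ nonZeroDivisors R) (β : Fin n →₀ ℕ) :
    (shift (fun k => z k (β k)) (newton z β)).coeff (nodeOrder z β) ∈ nonZeroDivisors R := by
  have h : shift (fun k => z k (β k)) (newton z β) = monomial (nodeOrder z β) 1 *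
      ∏ k, ∏ l ∈ (Finset.range (β k)).filter (fun l => ¬ z k l = z k (β k)),
        (X k + C (z k (β k) - z k l)) := by
    rw [shift_newton, monomial_eq, C_1, one_mul, Finsupp.prod_fintype _ _ (by simp),
      ← Finset.prod_mul_distrib]
    refine Finset.prod_congr rfl fun k _ => ?_
    rw [← Finset.prod_filter_mul_prod_filter_not _ (fun l => z k l = z k (β k))]
    congr 1
    rw [Finset.prod_congr rfl (g := fun _ => X k), Finset.prod_const]
    · rfl
    · intro l hl
      simp [(Finset.mem_filter.1 hl).2]
  rw [h, coeff_monomial_mul', if_pos le_rfl, tsub_self, one_mul]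
  change constantCoeff _ ∈ _
  simp only [map_prod]
  refine Submonoid.prod_mem _ fun k _ => Submonoid.prod_mem _ fun l hl => ?_
  simpa using hz k _ _ (Ne.symm (Finset.mem_filter.1 hl).2)

/-- Triangularity of the Newton basis with respect to the coefficients of order `nodeOrder z β` at
the points `z(β)`. -/
theorem newton_coeff_eq_zero [DecidableEq R] (z : Fin n → ℕ → R)
    (hz : ∀ k l l', z k l ≠ z k l' → z k l - z k l' ∈ nonZeroDivisors R)
    (c : (Fin n →₀ ℕ) →₀ R) (B : Set (Fin n →₀ ℕ)) (hB : IsLowerSet B)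
    (h : ∀ β ∈ B, (shift (fun k => z k (β k))
      (∑ γ ∈ c.support, C (c γ) * newton z γ)).coeff (nodeOrder z β) = 0) :
    ∀ β ∈ B, c β = 0 := by
  intro β
  induction β using WellFoundedLT.induction with
  | _ β ih =>
    intro hβ
    have h1 := h β hβ
    simp only [← shiftHom_apply, map_sum, map_mul, coeff_sum] at h1
    simp only [shiftHom, algHom_C, algebraMap_eq, coeff_C_mul] at h1
    rw [Finset.sum_eq_single β] at h1
    · exact (mem_nonZeroDivisors_iff.1 (coeff_shift_newton_self z hz β)).2 _ h1
    · intro γ _ hne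
      by_cases hle : γ ≤ β
      · rw [ih γ (lt_of_le_of_ne hle hne) (hB hle hβ), zero_mul]
      · rw [show coeff (nodeOrder z β) (bind₁ (fun i => X i + C (z i (β i))) (newton z γ)) = 0 from
          coeff_shift_newton_of_not_le z hle, mul_zero]
    · intro hs
      rw [Finsupp.notMem_support_iff.1 hs, zero_mul]

end NewtonBasis

section Nullstellensatz

variable {R : Type*} [CommRing R] {n : ℕ}

theorem exists_le_sum_eq {ι : Type*} [Fintype ι] (q : ι → ℕ) (t : ℕ) (ht : t ≤ ∑ k, q k) :
    ∃ α : ι → ℕ, (∀ k, α k ≤ q k) ∧ ∑ k, α k = t := by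
  classical
  induction t with
  | zero => exact ⟨0, fun _ => Nat.zero_le _, by simp⟩
  | succ t ih =>
    obtain ⟨α, h1, h2⟩ := ih (Nat.le_of_succ_le ht)
    obtain ⟨k, -, hk⟩ := Finset.exists_lt_of_sum_lt (s := Finset.univ) (f := α) (g := q) (by omega)
    refine ⟨α + Pi.single k 1, fun j => ?_, ?_⟩
    · by_cases h : j = k
      · subst h
        simpa using hk
      · simpa [h] using h1 j
    · simp [Finset.sum_add_distrib, h2]

/-- The exponents that are not coordinatewise at least `(d_k α_k)_k` for any `α` of sum `t`. -/
def reducedExponents (d : Fin n → ℕ) (t : ℕ) : Set (Fin n →₀ ℕ) :=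
  {β | ∀ α : Fin n → ℕ, ∑ i, α i = t → ∃ k, β k < d k * α k}

theorem isLowerSet_reducedExponents (d : Fin n → ℕ) (t : ℕ) :
    IsLowerSet (reducedExponents d t) := by
  intro β γ hle hβ α hα
  obtain ⟨k, hk⟩ := hβ α hα
  exact ⟨k, (hle k).trans_lt hk⟩

theorem pos_of_mem_reducedExponents {d : Fin n → ℕ} {t : ℕ} {β : Fin n →₀ ℕ}
    (hβ : β ∈ reducedExponents d t) (k : Fin n) : 0 < d k := by
  obtain ⟨j, hj⟩ := hβ (Pi.single k t) (by simp)
  by_cases h : j = k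
  · subst h
    exact Nat.pos_of_ne_zero fun h0 => by simp [h0] at hj
  · simp [h] at hj

theorem sum_div_lt_of_mem_reducedExponents {d : Fin n → ℕ} {t : ℕ} {β : Fin n →₀ ℕ}
    (hβ : β ∈ reducedExponents d t) : ∑ k, β k / d k < t := by
  by_contra! h
  obtain ⟨α, h1, h2⟩ := exists_le_sum_eq _ t h
  obtain ⟨k, hk⟩ := hβ α h2
  have := Nat.mul_le_mul_left (d k) (h1 k)
  have := Nat.mul_div_le (β k) (d k)
  omega

theorem VanishesToOrder.sub {ψ : Fin n → R → ℕ} {t : ℕ} {f g : MvPolynomial (Fin n) R}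
    {a : Fin n → R} (hf : VanishesToOrder ψ t f a) (hg : VanishesToOrder ψ t g a) :
    VanishesToOrder ψ t (f - g) a := by
  intro β hβ
  rw [← shiftHom_apply, map_sub, coeff_sub, shiftHom_apply, shiftHom_apply, hf β hβ, hg β hβ,
    sub_zero]

theorem vanishesToOrder_of_mem_powIdeal {ψ : Fin n → R → ℕ} {t : ℕ} {f : MvPolynomial (Fin n) R}
    {a : Fin n → R} (g : Fin n → MvPolynomial (Fin n) R) (hψ : ∀ k, 0 < ψ k (a k))
    (hg : ∀ k, (X k - C (a k)) ^ ψ k (a k) ∣ g k) (hf : f ∈ powIdeal t g) :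
    VanishesToOrder ψ t f a := by
  refine Submodule.span_induction (p := fun f _ => VanishesToOrder ψ t f a) ?_ ?_ ?_ ?_ hf
  · rintro _ ⟨α, hα, rfl⟩ β hβ
    have hdvd : monomial (Finsupp.equivFunOnFinite.symm fun k => ψ k (a k) * α k) (1 : R) ∣
        shift a (∏ k, g k ^ α k) := by
      rw [← shiftHom_apply, map_prod, monomial_eq, C_1, one_mul,
        Finsupp.prod_fintype _ _ (by simp)]
      refine Finset.prod_dvd_prod_of_dvd _ _ fun k _ => ?_
      rw [Finsupp.equivFunOnFinite_symm_apply_apply, pow_mul, map_pow]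
      refine pow_dvd_pow_of_dvd ?_ _
      have h := map_dvd (shiftHom a) (hg k)
      rwa [map_pow, shiftHom_apply, shift_X_sub_C, sub_self, C_0, add_zero] at h
    obtain ⟨q, hq⟩ := hdvd
    rw [hq, coeff_monomial_mul', if_neg]
    intro hle
    refine absurd hβ (not_lt.2 ?_)
    rw [← hα]
    refine Finset.sum_le_sum fun k _ => ?_
    rw [Nat.le_div_iff_mul_le (hψ k), mul_comm]
    exact hle k
  · intro β _
    rw [← shiftHom_apply, map_zero, coeff_zero]
  · intro p q _ _ hp hq β hβ
    rw [← shiftHom_apply, map_add, coeff_add, shiftHom_apply, shiftHom_apply, hp β hβ, hq β hβ,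
      add_zero]
  · intro r p _ hp β hβ
    rw [smul_eq_mul, ← shiftHom_apply, map_mul, coeff_mul]
    refine Finset.sum_eq_zero fun x hx => ?_
    rw [shiftHom_apply, shiftHom_apply, hp x.2, mul_zero]
    refine lt_of_le_of_lt (Finset.sum_le_sum fun k _ => Nat.div_le_div_right ?_) hβ
    rw [← Finset.HasAntidiagonal.mem_antidiagonal.1 hx]
    exact Nat.le_add_left _ _

theorem eval_eq_zero_of_vanishesToOrder {ψ : Fin n → R → ℕ} {t : ℕ} (ht : 1 ≤ t)
    {f : MvPolynomial (Fin n) R} {a : Fin n → R} (h : VanishesToOrder ψ t f a) :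
    eval a f = 0 := by
  have h0 := h 0 (by simpa using Nat.pos_of_ne_zero (by omega : t ≠ 0))
  have hom : (constantCoeff.comp (shiftHom a).toRingHom) = eval a := by
    refine ringHom_ext (fun r => ?_) fun i => ?_ <;> simp [shiftHom, algHom_C]
  rw [← hom]
  exact h0

theorem dvd_multisetPoly (k : Fin n) {A : Finset R} (ψ : R → ℕ) {u : R} (hu : u ∈ A) :
    (X k - C u) ^ ψ u ∣ multisetPoly k A ψ :=
  Finset.dvd_prod_of_mem (fun u => (X k - C u) ^ ψ u) hu

theorem vanishesToOrder_of_mem_powIdeal_multisetPoly {S : Fin n → Finset R} {ψ : Fin n → R → ℕ}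
    (hψ : ∀ k, ∀ u ∈ S k, 0 < ψ k u) {t : ℕ} {f : MvPolynomial (Fin n) R}
    (hf : f ∈ powIdeal t fun k => multisetPoly k (S k) (ψ k)) {a : Fin n → R}
    (ha : ∀ i, a i ∈ S i) : VanishesToOrder ψ t f a :=
  vanishesToOrder_of_mem_powIdeal _ (fun k => hψ k _ (ha k))
    (fun k => dvd_multisetPoly k (ψ k) (ha k)) hf

variable [DecidableEq R]

/-- Node sequences running periodically through `(S_k, ψ_k)`, through `S_k \ E_k` first. -/
noncomputable def nodes (S E : Fin n → Finset R) (ψ : Fin n → R → ℕ) (k : Fin n) : ℕ → R :=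
  cycle (nodeList (S k) (E k) (ψ k))

variable {S E : Fin n → Finset R} {ψ : Fin n → R → ℕ}

theorem nodes_mem (hE : ∀ k, E k ⊆ S k) {k : Fin n} (hk : 0 < ∑ u ∈ S k, ψ k u) (i : ℕ) :
    nodes S E ψ k i ∈ S k :=
  mem_of_mem_nodeList (hE k) _ (cycle_mem _ (by rwa [length_nodeList (hE k)]) i)

theorem nodes_sub_mem_nonZeroDivisors (hE : ∀ k, E k ⊆ S k)
    (hD : ∀ k, ConditionD (S k : Set R)) (k : Fin n) (l l' : ℕ)
    (h : nodes S E ψ k l ≠ nodes S E ψ k l') :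
    nodes S E ψ k l - nodes S E ψ k l' ∈ nonZeroDivisors R := by
  rcases Nat.eq_zero_or_pos (∑ u ∈ S k, ψ k u) with h0 | hk
  · rw [← length_nodeList (hE k), List.length_eq_zero_iff] at h0
    simp [nodes, h0, cycle] at h
  · exact hD k _ (nodes_mem hE hk l') _ (nodes_mem hE hk l) h.symm

theorem coeff_nodeOrder_eq_zero (hE : ∀ k, E k ⊆ S k) {t : ℕ} {f : MvPolynomial (Fin n) R}
    {β : Fin n →₀ ℕ} (hβ : β ∈ reducedExponents (fun k => ∑ u ∈ S k, ψ k u) t)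
    (hf : VanishesToOrder ψ t f fun k => nodes S E ψ k (β k)) :
    (shift (fun k => nodes S E ψ k (β k)) f).coeff (nodeOrder (nodes S E ψ) β) = 0 := by
  refine hf _ (lt_of_le_of_lt (Finset.sum_le_sum fun k _ => ?_)
    (sum_div_lt_of_mem_reducedExponents hβ))
  have hk := pos_of_mem_reducedExponents hβ k
  have h := card_filter_cycle (nodeList (S k) (E k) (ψ k))
    (by rwa [length_nodeList (hE k)]) (β k)
  have hcount : (nodeList (S k) (E k) (ψ k)).count (nodes S E ψ k (β k)) = _ :=
    count_nodeList (ψ k) (nodes_mem hE hk (β k))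
  rw [length_nodeList (hE k), ← nodes, hcount] at h
  exact h.le

theorem newton_nodes_coeff_eq_zero (hE : ∀ k, E k ⊆ S k) (hD : ∀ k, ConditionD (S k : Set R))
    {t : ℕ} {c : (Fin n →₀ ℕ) →₀ R} {B : Set (Fin n →₀ ℕ)} (hB : IsLowerSet B)
    (hBD : B ⊆ reducedExponents (fun k => ∑ u ∈ S k, ψ k u) t)
    (h : ∀ β ∈ B, VanishesToOrder ψ t (∑ γ ∈ c.support, C (c γ) * newton (nodes S E ψ) γ)
      fun k => nodes S E ψ k (β k)) :
    ∀ β ∈ B, c β = 0 :=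
  newton_coeff_eq_zero _ (nodes_sub_mem_nonZeroDivisors hE hD) c B hB fun β hβ =>
    coeff_nodeOrder_eq_zero hE (hBD hβ) (h β hβ)

theorem eq_zero_of_vanishesToOrder (hD : ∀ k, ConditionD (S k : Set R)) {t : ℕ}
    {f : MvPolynomial (Fin n) R}
    (hf : ∀ β ∈ f.support, β ∈ reducedExponents (fun k => ∑ u ∈ S k, ψ k u) t)
    (h : ∀ a : Fin n → R, (∀ i, a i ∈ S i) → VanishesToOrder ψ t f a) : f = 0 := by
  have hE : ∀ k, S k ⊆ S k := fun k => subset_rfl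
  obtain ⟨c, hc, rfl⟩ := exists_eq_sum_newton (nodes S S ψ) f
    fun γ hγ β hβ => isLowerSet_reducedExponents _ _ hβ (hf γ hγ)
  refine Finset.sum_eq_zero fun β hβ => ?_
  rw [newton_nodes_coeff_eq_zero hE hD (isLowerSet_reducedExponents _ _) subset_rfl
    (fun γ hγ => h _ fun i => nodes_mem hE (pos_of_mem_reducedExponents hγ i) _) β (hc β hβ),
    C_0, zero_mul]

theorem newton_nodes_mem_powIdeal (hE : ∀ k, E k ⊆ S k) {t : ℕ} {β : Fin n →₀ ℕ}
    (hβ : β ∉ reducedExponents (fun k => ∑ u ∈ S k, ψ k u) t) :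
    newton (nodes S E ψ) β ∈ powIdeal t fun k => multisetPoly k (S k) (ψ k) := by
  simp only [reducedExponents, Set.mem_ofPred_eq] at hβ
  push Not at hβ
  obtain ⟨α, hα, h⟩ := hβ
  refine Ideal.mem_of_dvd _ (newton_dvd _ h) (Ideal.subset_span ⟨α, hα, ?_⟩)
  exact Finset.prod_congr rfl fun k _ =>
    prod_range_mul_cycle_nodeList (hE k) (ψ k) (fun u => X k - C u) (α k)

theorem exists_isReducedRemainder (S : Fin n → Finset R) (ψ : Fin n → R → ℕ) (t : ℕ)
    (f : MvPolynomial (Fin n) R) :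
    ∃ η, IsReducedRemainder S ψ t f η ∧ ∀ β ∈ η.support, ∃ γ ∈ f.support, β ≤ γ := by
  classical
  have hE : ∀ k, S k ⊆ S k := fun k => subset_rfl
  set D := reducedExponents (fun k => ∑ u ∈ S k, ψ k u) t
  obtain ⟨c, hc, hf⟩ := exists_eq_sum_newton (nodes S S ψ) f
    (D := {β | ∃ γ ∈ f.support, β ≤ γ}) fun γ hγ β hβ => ⟨γ, hγ, hβ⟩
  have hsupp : ∀ β ∈ (∑ γ ∈ c.support with γ ∈ D, C (c γ) * newton (nodes S S ψ) γ).support,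
      ∃ γ ∈ c.support, γ ∈ D ∧ β ≤ γ := by
    intro β hβ
    obtain ⟨γ, hγ, h⟩ := Finset.mem_biUnion.1 (support_sum hβ)
    obtain ⟨h1, h2⟩ := Finset.mem_filter.1 hγ
    refine ⟨γ, h1, h2, le_of_mem_support_newton (nodes S S ψ) ?_⟩
    rw [mem_support_iff, coeff_C_mul] at h
    exact mem_support_iff.2 (right_ne_zero_of_mul h)
  refine ⟨∑ γ ∈ c.support with γ ∈ D, C (c γ) * newton (nodes S S ψ) γ, ⟨?_, ?_⟩, ?_⟩
  · nth_rw 1 [hf]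
    rw [← Finset.sum_filter_add_sum_filter_not c.support (· ∈ D), add_sub_cancel_left]
    exact Ideal.sum_mem _ fun γ hγ => Ideal.mul_mem_left _ _
      (newton_nodes_mem_powIdeal hE (Finset.mem_filter.1 hγ).2)
  · intro β hβ
    obtain ⟨γ, -, hγ, hle⟩ := hsupp β hβ
    exact isLowerSet_reducedExponents _ _ hle hγ
  · intro β hβ
    obtain ⟨γ, hγ, -, hle⟩ := hsupp β hβ
    obtain ⟨δ, hδ, h⟩ := hc γ hγ
    exact ⟨δ, hδ, hle.trans h⟩

theorem IsReducedRemainder.unique (hψ : ∀ k, ∀ u ∈ S k, 0 < ψ k u)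
    (hD : ∀ k, ConditionD (S k : Set R)) {t : ℕ} {f η η' : MvPolynomial (Fin n) R}
    (h : IsReducedRemainder S ψ t f η) (h' : IsReducedRemainder S ψ t f η') : η' = η := by
  rw [← sub_eq_zero]
  refine eq_zero_of_vanishesToOrder (S := S) (ψ := ψ) (t := t) hD ?_ fun a ha => ?_
  · intro β hβ
    rcases Finset.mem_union.1 (support_sub _ _ _ hβ) with h1 | h1
    · exact h'.2 β h1
    · exact h.2 β h1
  · refine vanishesToOrder_of_mem_powIdeal_multisetPoly hψ ?_ ha
    have := Ideal.sub_mem _ h.1 h'.1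
    rwa [sub_sub_sub_cancel_left] at this

/-- The Nullstellensatz with multiplicities for a full grid. -/
theorem mem_powIdeal_iff (hψ : ∀ k, ∀ u ∈ S k, 0 < ψ k u) (hD : ∀ k, ConditionD (S k : Set R))
    {t : ℕ} {f : MvPolynomial (Fin n) R} :
    f ∈ powIdeal t (fun k => multisetPoly k (S k) (ψ k)) ↔
      ∀ a : Fin n → R, (∀ i, a i ∈ S i) → VanishesToOrder ψ t f a := by
  refine ⟨fun hf a ha => vanishesToOrder_of_mem_powIdeal_multisetPoly hψ hf ha, fun h => ?_⟩
  obtain ⟨η, hη, -⟩ := exists_isReducedRemainder S ψ t f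
  have h0 : η = 0 := eq_zero_of_vanishesToOrder hD hη.2 fun a ha => by
    have := (h a ha).sub (vanishesToOrder_of_mem_powIdeal_multisetPoly hψ hη.1 ha)
    rwa [sub_sub_cancel] at this
  simpa [h0] using hη.1

theorem mem_iInf_powIdeal_iff (hψ : ∀ k, ∀ u ∈ S k, 0 < ψ k u)
    (hD : ∀ k, ConditionD (S k : Set R)) {t : ℕ} {f : MvPolynomial (Fin n) R} :
    f ∈ ⨅ m : Fin n, powIdeal t (Function.update (fun k => multisetPoly k (S k) (ψ k)) m
        (quotPoly m (S m) (E m) (ψ m))) ↔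
      ∀ a : Fin n → R, (∀ i, a i ∈ S i) → ¬ (∀ i, a i ∈ E i) → VanishesToOrder ψ t f a := by
  have hsub : ∀ m k, Function.update S m (S m \ E m) k ⊆ S k := by
    intro m k
    by_cases h : k = m
    · subst h
      simp
    · simp [h]
  have key : ∀ m : Fin n, f ∈ powIdeal t (Function.update (fun k => multisetPoly k (S k) (ψ k)) m
        (quotPoly m (S m) (E m) (ψ m))) ↔
      ∀ a : Fin n → R, (∀ i, a i ∈ Function.update S m (S m \ E m) i) →
        VanishesToOrder ψ t f a := by
    intro m
    rw [← mem_powIdeal_iff (fun k u hu => hψ k u (hsub m k hu))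
      (fun k a ha b hb => hD k a (hsub m k ha) b (hsub m k hb))]
    have h : Function.update (fun k => multisetPoly k (S k) (ψ k)) m
        (quotPoly m (S m) (E m) (ψ m)) =
        fun k => multisetPoly k (Function.update S m (S m \ E m) k) (ψ k) := by
      funext k
      by_cases h : k = m
      · subst h
        simp [quotPoly]
      · simp [h]
    rw [h]
  simp only [Ideal.mem_iInf, key]
  constructor
  · intro h a ha hne
    push Not at hne
    obtain ⟨m, hm⟩ := hne
    refine h m a fun k => ?_
    by_cases hk : k = m
    · subst hk
      simp [ha k, hm]
    · simp [hk, ha k]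
  · intro h m a ha
    refine h a (fun k => hsub m k (ha k)) fun hall => ?_
    have := ha m
    simp [hall m] at this

theorem prod_quotPoly_dvd (hE : ∀ k, E k ⊆ S k) (hD : ∀ k, ConditionD (S k : Set R)) {t : ℕ}
    {η : MvPolynomial (Fin n) R}
    (hη : ∀ β ∈ η.support, β ∈ reducedExponents (fun k => ∑ u ∈ S k, ψ k u) t)
    (h : ∀ a : Fin n → R, (∀ i, a i ∈ S i) → ¬ (∀ i, a i ∈ E i) → VanishesToOrder ψ t η a) :
    ∏ k, quotPoly k (S k) (E k) (ψ k) ∣ η := by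
  obtain ⟨c, hc, rfl⟩ := exists_eq_sum_newton (nodes S E ψ) η
    fun γ hγ β hβ => isLowerSet_reducedExponents _ _ hβ (hη γ hγ)
  set D := reducedExponents (fun k => ∑ u ∈ S k, ψ k u) t
  have hlow : IsLowerSet {β : Fin n →₀ ℕ | β ∈ D ∧ ∃ m, β m < ∑ u ∈ S m \ E m, ψ m u} := by
    rintro β γ hle ⟨h1, m, h2⟩
    exact ⟨isLowerSet_reducedExponents _ _ hle h1, m, (hle m).trans_lt h2⟩
  have hzero := newton_nodes_coeff_eq_zero hE hD hlow (fun _ hβ => hβ.1) (c := c) (by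
    rintro β ⟨h1, m, h2⟩
    refine h _ (fun i => nodes_mem hE (pos_of_mem_reducedExponents h1 i) _) fun hall => ?_
    exact cycle_nodeList_mem_sdiff (S m) (E m) (ψ m) h2 (hall m))
  refine Finset.dvd_sum fun β hβ => Dvd.dvd.mul_left ?_ _
  have hle : ∀ k, ∑ u ∈ S k \ E k, ψ k u ≤ β k := by
    by_contra! hlt
    exact Finsupp.mem_support_iff.1 hβ (hzero β ⟨hc β hβ, hlt⟩)
  have hprod : ∏ k, quotPoly k (S k) (E k) (ψ k) = ∏ k, ∏ l ∈ Finset.range (∑ u ∈ S k \ E k, ψ k u),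
      (X k - C (nodes S E ψ k l)) :=
    Finset.prod_congr rfl fun k _ =>
      (prod_range_sdiff_cycle_nodeList (S k) (E k) (ψ k) fun u => X k - C u).symm
  rw [hprod]
  exact newton_dvd _ hle

end Nullstellensatz

section Degree

variable {R : Type*} [CommRing R] {n : ℕ}

theorem totalDegree_le_of_support_le {f η : MvPolynomial (Fin n) R}
    (h : ∀ β ∈ η.support, ∃ γ ∈ f.support, β ≤ γ) : η.totalDegree ≤ f.totalDegree := by
  refine Finset.sup_le fun β hβ => ?_
  obtain ⟨γ, hγ, hle⟩ := h β hβ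
  refine le_trans ?_ (le_totalDegree hγ)
  rw [Finsupp.sum_fintype _ _ (by simp), Finsupp.sum_fintype _ _ (by simp)]
  exact Finset.sum_le_sum fun i _ => hle i

theorem monic_multisetPoly (mo : MonomialOrder (Fin n)) (k : Fin n) (A : Finset R) (ψ : R → ℕ) :
    mo.Monic (multisetPoly k A ψ) :=
  MonomialOrder.Monic.prod fun u _ => (MonomialOrder.monic_X_sub_C _ k u).pow

theorem degree_multisetPoly [Nontrivial R] (mo : MonomialOrder (Fin n)) (k : Fin n) (A : Finset R)
    (ψ : R → ℕ) : mo.degree (multisetPoly k A ψ) = Finsupp.single k (∑ u ∈ A, ψ u) := by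
  rw [multisetPoly, mo.degree_prod_of_mem_nonZeroDivisors, Finsupp.single_finsetSum]
  · refine Finset.sum_congr rfl fun u _ => ?_
    rw [mo.degree_pow_of_pow_leadingCoeff_ne_zero, mo.degree_X_sub_C, Finsupp.smul_single]
    · simp
    · rw [(mo.monic_X_sub_C k u).leadingCoeff_eq_one, one_pow]
      exact one_ne_zero
  · intro u _
    rw [((mo.monic_X_sub_C k u).pow).leadingCoeff_eq_one]
    exact one_mem _

theorem totalDegree_prod_multisetPoly_mul [Nontrivial R] (A : Fin n → Finset R)
    (ψ : Fin n → R → ℕ) {ζ : MvPolynomial (Fin n) R} (hζ : ζ ≠ 0) :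
    ((∏ k, multisetPoly k (A k) (ψ k)) * ζ).totalDegree =
      ∑ k, ∑ u ∈ A k, ψ k u + ζ.totalDegree := by
  have hone : ∀ {p : MvPolynomial (Fin n) R}, MonomialOrder.degLex.Monic p →
      MonomialOrder.degLex.leadingCoeff p ∈ nonZeroDivisors R := fun hp => by
    rw [hp.leadingCoeff_eq_one]
    exact one_mem _
  rw [← degree_degLexDegree,
    MonomialOrder.degLex.degree_mul_of_left_mem_nonZeroDivisors
      (hone (MonomialOrder.Monic.prod fun k _ => monic_multisetPoly _ k (A k) (ψ k))) hζ,
    map_add, degree_degLexDegree (f := ζ),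
    MonomialOrder.degLex.degree_prod_of_mem_nonZeroDivisors
      fun k _ => hone (monic_multisetPoly _ k (A k) (ψ k)), map_sum]
  simp [degree_multisetPoly]

/-- Evaluation of all the variables except `x_m` at the point `w`. -/
noncomputable def lineHom (w : Fin n → R) (m : Fin n) :
    MvPolynomial (Fin n) R →ₐ[R] Polynomial R :=
  aeval (Function.update (fun k => Polynomial.C (w k)) m Polynomial.X)

theorem lineHom_multisetPoly_self (w : Fin n → R) (m : Fin n) (A : Finset R) (ψ : R → ℕ) :
    lineHom w m (multisetPoly m A ψ) = ∏ u ∈ A, (Polynomial.X - Polynomial.C u) ^ ψ u := by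
  simp [lineHom, multisetPoly, algHom_C]

theorem lineHom_of_ne (w : Fin n → R) {m k : Fin n} (hk : k ≠ m) (A : Finset R) (ψ : R → ℕ) :
    lineHom w m (multisetPoly k A ψ) = Polynomial.C (∏ u ∈ A, (w k - u) ^ ψ u) := by
  simp [lineHom, multisetPoly, algHom_C, hk]

theorem eval_lineHom (w : Fin n → R) (m : Fin n) (f : MvPolynomial (Fin n) R) :
    (lineHom w m f).eval (w m) = eval w f := by
  have hom : (Polynomial.evalRingHom (w m)).comp (lineHom w m).toRingHom = eval w := by
    refine ringHom_ext (fun r => ?_) fun i => ?_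
    · simp [lineHom, algHom_C]
    · by_cases h : i = m
      · subst h
        simp [lineHom]
      · simp [lineHom, h]
  rw [← hom]
  rfl

theorem natDegree_lineHom_le (w : Fin n → R) (m : Fin n) (f : MvPolynomial (Fin n) R) :
    (lineHom w m f).natDegree ≤ f.totalDegree := by
  have h := aeval_natDegree_le f le_rfl
    (Function.update (fun k => Polynomial.C (w k)) m Polynomial.X) (n := 1) fun i => by
      by_cases h : i = m
      · subst h
        simpa using Polynomial.natDegree_X_le
      · simp [h]
  simpa [lineHom] using h

theorem pow_lineHom_dvd (w : Fin n → R) (m : Fin n) (g : Fin n → MvPolynomial (Fin n) R)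
    (hg : ∀ k, k ≠ m → lineHom w m (g k) = 0) {t : ℕ} {f : MvPolynomial (Fin n) R}
    (hf : f ∈ powIdeal t g) : lineHom w m (g m) ^ t ∣ lineHom w m f := by
  have hle : powIdeal t g ≤ (Ideal.span {lineHom w m (g m) ^ t}).comap (lineHom w m) := by
    refine Ideal.span_le.2 ?_
    rintro _ ⟨α, hα, rfl⟩
    simp only [SetLike.mem_coe, Ideal.mem_comap, Ideal.mem_span_singleton, map_prod, map_pow]
    by_cases h : ∀ k, k ≠ m → α k = 0
    · have hm : α m = t := by
        rw [← hα, Finset.sum_eq_single m (fun k _ hk => h k hk) (by simp)]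
      rw [← hm]
      exact Finset.dvd_prod_of_mem (fun k => lineHom w m (g k) ^ α k) (Finset.mem_univ m)
    · push Not at h
      obtain ⟨k, hk, hne⟩ := h
      rw [Finset.prod_eq_zero (Finset.mem_univ k) (by rw [hg k hk, zero_pow hne])]
      exact dvd_zero _
  exact Ideal.mem_span_singleton.1 (hle hf)

theorem le_totalDegree_of_eval_ne_zero [DecidableEq R] {S E : Fin n → Finset R}
    {ψ : Fin n → R → ℕ} (hψ : ∀ k, ∀ u ∈ S k, 0 < ψ k u) {t : ℕ} (ht : 1 ≤ t)
    {η : MvPolynomial (Fin n) R} (m : Fin n)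
    (hη : η ∈ powIdeal t (Function.update (fun k => multisetPoly k (S k) (ψ k)) m
      (quotPoly m (S m) (E m) (ψ m))))
    (hdvd : ∏ k, quotPoly k (S k) (E k) (ψ k) ∣ η) {w : Fin n → R} (hw : ∀ i, w i ∈ S i)
    (hne : eval w η ≠ 0) :
    (t - 1) * (∑ u ∈ S m \ E m, ψ m u) + ∑ k, ∑ u ∈ S k \ E k, ψ k u ≤ η.totalDegree := by
  obtain ⟨ζ, rfl⟩ := hdvd
  have hR : Nontrivial R := ⟨_, _, hne⟩
  have hζ : ζ ≠ 0 := by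
    rintro rfl
    simp at hne
  rw [show ∏ k, quotPoly k (S k) (E k) (ψ k) = ∏ k, multisetPoly k (S k \ E k) (ψ k) from rfl]
    at hη hne ⊢
  rw [totalDegree_prod_multisetPoly_mul (fun k => S k \ E k) ψ hζ, add_comm]
  refine Nat.add_le_add_left ?_ _
  set Q : Polynomial R := ∏ u ∈ S m \ E m, (Polynomial.X - Polynomial.C u) ^ ψ m u with hQ
  have hQm : Q.Monic :=
    Polynomial.monic_prod_of_monic _ _ fun u _ => (Polynomial.monic_X_sub_C u).pow _
  have hQd : Q.natDegree = ∑ u ∈ S m \ E m, ψ m u := by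
    rw [hQ, Polynomial.natDegree_prod_of_monic _ _
      fun u _ => (Polynomial.monic_X_sub_C u).pow _]
    refine Finset.sum_congr rfl fun u _ => ?_
    rw [(Polynomial.monic_X_sub_C u).natDegree_pow, Polynomial.natDegree_X_sub_C, mul_one]
  have h1 := pow_lineHom_dvd w m _ (fun k hk => by
    rw [Function.update_of_ne hk, lineHom_of_ne w hk, Finset.prod_eq_zero (hw k), map_zero]
    rw [sub_self, zero_pow (hψ k _ (hw k)).ne']) hη
  rw [Function.update_self, quotPoly, lineHom_multisetPoly_self, ← hQ] at h1
  set c : R := ∏ k ∈ Finset.univ.erase m, ∏ u ∈ S k \ E k, (w k - u) ^ ψ k u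
  have h2 : lineHom w m ((∏ k, multisetPoly k (S k \ E k) (ψ k)) * ζ) =
      Q * (Polynomial.C c * lineHom w m ζ) := by
    rw [map_mul, map_prod, ← Finset.mul_prod_erase _ _ (Finset.mem_univ m),
      lineHom_multisetPoly_self, ← hQ,
      Finset.prod_congr rfl fun k hk => lineHom_of_ne w (Finset.ne_of_mem_erase hk) _ _,
      ← map_prod, mul_assoc]
  have h3 : Polynomial.C c * lineHom w m ζ ≠ 0 := fun h0 => by
    rw [← eval_lineHom w m, h2, h0] at hne
    simp at hne
  obtain ⟨s, rfl⟩ := Nat.exists_eq_add_of_le' ht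
  rw [h2, pow_succ'] at h1
  obtain ⟨p, hp⟩ := h1
  rw [mul_assoc] at hp
  have hcancel := hQm.isRegular.left hp
  have h4 : (Q ^ s).natDegree ≤ (Polynomial.C c * lineHom w m ζ).natDegree := by
    by_contra! hlt
    exact (hQm.pow s).not_dvd_of_natDegree_lt h3 hlt ⟨p, hcancel⟩
  rw [hQm.natDegree_pow, hQd] at h4
  exact h4.trans ((Polynomial.natDegree_C_mul_le _ _).trans (natDegree_lineHom_le w m ζ))

end Degree

end PuncturedNSS


theorem theorem5p3 {R : Type*} [CommRing R] [DecidableEq R] (n : ℕ) (hn : 1 ≤ n)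
    (S E : Fin n → Finset R) (hE : ∀ k, E k ⊆ S k)
    (ψ : Fin n → R → ℕ) (hψ : ∀ k, ∀ u ∈ S k, 0 < ψ k u)
    (hD : ∀ k, PuncturedNSS.ConditionD (S k : Set R))
    (t : ℕ) (f : MvPolynomial (Fin n) R) :
    (f ∈ ⨅ m : Fin n, PuncturedNSS.powIdeal t
          (Function.update (fun k => PuncturedNSS.multisetPoly k (S k) (ψ k)) m
            (PuncturedNSS.quotPoly m (S m) (E m) (ψ m))) ↔
        ∀ a : Fin n → R, (∀ i, a i ∈ S i) → ¬ (∀ i, a i ∈ E i) →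
          PuncturedNSS.VanishesToOrder ψ t f a) ∧
      ((∀ a : Fin n → R, (∀ i, a i ∈ S i) → ¬ (∀ i, a i ∈ E i) →
          PuncturedNSS.VanishesToOrder ψ t f a) →
        ∃ η : MvPolynomial (Fin n) R,
          PuncturedNSS.IsReducedRemainder S ψ t f η ∧
          (∀ η' : MvPolynomial (Fin n) R,
            PuncturedNSS.IsReducedRemainder S ψ t f η' → η' = η) ∧
          (∀ β ∈ η.support, ∃ γ ∈ f.support, β ≤ γ) ∧
          (∏ k, PuncturedNSS.quotPoly k (S k) (E k) (ψ k)) ∣ η ∧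
          (1 ≤ t → (∃ w : Fin n → R, (∀ i, w i ∈ S i) ∧ MvPolynomial.eval w f ≠ 0) →
            η ≠ 0 ∧
            ∀ m : Fin n,
              η.totalDegree ≤ f.totalDegree ∧
              (t - 1) * (∑ u ∈ S m \ E m, ψ m u) + ∑ k, ∑ u ∈ S k \ E k, ψ k u
                ≤ η.totalDegree)) := by
  refine ⟨PuncturedNSS.mem_iInf_powIdeal_iff hψ hD, fun h => ?_⟩
  obtain ⟨η, hη, hsupp⟩ := PuncturedNSS.exists_isReducedRemainder S ψ t f
  have hdiff : ∀ a : Fin n → R, (∀ i, a i ∈ S i) → PuncturedNSS.VanishesToOrder ψ t (f - η) a :=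
    fun a ha => PuncturedNSS.vanishesToOrder_of_mem_powIdeal_multisetPoly hψ hη.1 ha
  have hvan : ∀ a : Fin n → R, (∀ i, a i ∈ S i) → ¬ (∀ i, a i ∈ E i) →
      PuncturedNSS.VanishesToOrder ψ t η a := fun a ha hne => by
    simpa using (h a ha hne).sub (hdiff a ha)
  have hdvd := PuncturedNSS.prod_quotPoly_dvd hE hD hη.2 hvan
  refine ⟨η, hη, fun η' hη' => PuncturedNSS.IsReducedRemainder.unique hψ hD hη hη', hsupp, hdvd,
    fun ht => ?_⟩
  rintro ⟨w, hw, hne⟩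
  have heval : MvPolynomial.eval w η ≠ 0 := by
    have h0 := PuncturedNSS.eval_eq_zero_of_vanishesToOrder ht (hdiff w hw)
    rw [map_sub, sub_eq_zero] at h0
    rwa [← h0]
  refine ⟨?_, fun m => ⟨PuncturedNSS.totalDegree_le_of_support_le hsupp, ?_⟩⟩
  · rintro rfl
    simp at heval
  · have hmem := (PuncturedNSS.mem_iInf_powIdeal_iff hψ hD).2 hvan
    exact PuncturedNSS.le_totalDegree_of_eval_ne_zero hψ ht m (Ideal.mem_iInf.1 hmem m) hdvd hw
      heval
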